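/- Let $F$ be a field of characteristic $0$, let $L$ be an $F$-vector space of countably infinite dimension, and let $E$ be the Grassmann (exterior) algebra of $L$. For nonzero integers $m<n$ and a decomposition $L=L_m\oplus L_n$ with both summands infinite-dimensional, choose a basis $e_1,e_2,\dots$ of $L$ contained in $L_m\cup L_n$, put $\|e_k\|=m$ if $e_k\in L_m$ and $\|e_k\|=n$ if $e_k\in L_n$. Let $E_{(m,n)}^{(\infty,\infty)}$ denote $E$ with the $\mathbb{Z}$-grading whose component of degree $r$ is spanned by the basis monomials $e_{i_1}\cdots e_{i_k}$ ($i_1<\dots<i_k$, $k\ge 0$) with $\|e_{i_1}\|+\dots+\|e_{i_k}\|=r$. Let $F\langle X\mid\mathbb{Z}\rangle$ be the free unital associative algebra on countably infinitely many variables of each degree $i\in\mathbb{Z}$. For a $\mathbb{Z}$-graded algebra $A$, let $T_{\mathbb{Z}}(A)$ be the ideal of graded polynomial identities of $A$, i.e. of all $f\in F\langle X\mid\mathbb{Z}\rangle$ that vanish whenever each variable of degree $i$ is replaced by an element of $A_i$. Two $\mathbb{Z}$-graded algebras $A,B$ are PI-equivalent if $T_{\mathbb{Z}}(A)=T_{\mathbb{Z}}(B)$.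 A $T_{\mathbb{Z}}$-ideal is a two-sided ideal of $F\langle X\mid\mathbb{Z}\rangle$ invariant under all graded endomorphisms; $A$ generates the variety defined by a set $S$ of polynomials if $T_{\mathbb{Z}}(A)$ is the $T_{\mathbb{Z}}$-ideal generated by $S$. Write $\alpha(x)$ for the degree of a variable $x$, and $[a,b]=ab-ba$, $[a,b,c]=[[a,b],c]$. Let $\mathfrak{V}_1$ be the variety defined by the polynomials $[x_1,x_2,x_3]$ for variables of all degrees, and $\mathfrak{V}_2$ the variety defined by the polynomials $[x_1,x_2]$ with $\alpha(x_1)$ or $\alpha(x_2)$ even and $x_1x_2+x_2x_1$ with $\alpha(x_1)$ and $\alpha(x_2)$ both odd. **Theorem.** Let $m<0<n$ be integers with $\gcd(m,n)=1$. Then every homogeneous component of $E_{(m,n)}^{(\infty,\infty)}$ is nonzero, and: 1. if $mn$ is odd, then $E_{(m,n)}^{(\infty,\infty)}$ is PI-equivalent to $E_{(-1,1)}^{(\infty,\infty)}$ and generates $\mathfrak{V}_2$; 2. if $mn$ is even, then $E_{(m,n)}^{(\infty,\infty)}$ is PI-equivalent to $E_{(-1,2)}^{(\infty,\infty)}$ and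 generates $\mathfrak{V}_1$. Moreover, $E_{(-1,1)}^{(\infty,\infty)}$ and $E_{(-1,2)}^{(\infty,\infty)}$ are not PI-equivalent, so exactly one of the two alternatives holds. All of this holds for every choice of the decompositions and adapted bases of $L$ used to define the three graded algebras. -/

import Mathlib

open Module

namespace GradedGrassmann

noncomputable section

/-! ### Free `ℤ`-graded algebra, graded identities, `T`-ideals, PI-equivalence -/

section Identities

/-- The free unital associative algebra `F⟨X | ℤ⟩`. The variable of index `(i, k)` is the `k`-th
variable of degree `i`. -/
abbrev FreeGr (F : Type*) [Field F] : Type _ := FreeAlgebra F (ℤ × ℕ)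

/-- The `k`-th variable of degree `i`. -/
abbrev x (F : Type*) [Field F] (i : ℤ) (k : ℕ) : FreeGr F := FreeAlgebra.ι F (i, k)

/-- The homogeneous component of degree `i` of the free algebra: the span of the (noncommutative)
monomials whose variables have degrees with sum `i`. -/
def freeComponent (F : Type*) [Field F] (i : ℤ) : Submodule F (FreeGr F) :=
  Submodule.span F
    {f | ∃ l : List (ℤ × ℕ), (l.map Prod.fst).sum = i ∧ f = (l.map (FreeAlgebra.ι F)).prod}

variable {F : Type*} [Field F] {A B : Type*} [Ring A] [Algebra F A] [Ring B] [Algebra F B]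

/-- The ideal `T_ℤ(A)` of the `ℤ`-graded polynomial identities of a `ℤ`-graded algebra: the
polynomials which vanish under every substitution of each variable of degree `i` by an element of
the homogeneous component of degree `i`. -/
def gradedIdentities (𝒜 : ℤ → Submodule F A) [GradedAlgebra 𝒜] : TwoSidedIdeal (FreeGr F) :=
  TwoSidedIdeal.mk'
    {f | ∀ a : ℤ × ℕ → A, (∀ p, a p ∈ 𝒜 p.1) → FreeAlgebra.lift F a f = 0}
    (fun a _ => map_zero _)
    (fun hf hg a ha => by rw [map_add, hf a ha, hg a ha, add_zero])
    (fun hf a ha => by rw [map_neg, hf a ha, neg_zero])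
    (fun hg a ha => by rw [map_mul, hg a ha, mul_zero])
    (fun hf a ha => by rw [map_mul, hf a ha, zero_mul])

theorem mem_gradedIdentities (𝒜 : ℤ → Submodule F A) [GradedAlgebra 𝒜] (f : FreeGr F) :
    f ∈ gradedIdentities 𝒜 ↔
      ∀ a : ℤ × ℕ → A, (∀ p, a p ∈ 𝒜 p.1) → FreeAlgebra.lift F a f = 0 := by
  unfold gradedIdentities
  rw [TwoSidedIdeal.mem_mk']
  rfl

/-- Two `ℤ`-graded algebras are PI-equivalent if they satisfy the same graded identities. -/
def PIEquiv (𝒜 : ℤ → Submodule F A) [GradedAlgebra 𝒜]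
    (ℬ : ℤ → Submodule F B) [GradedAlgebra ℬ] : Prop :=
  gradedIdentities 𝒜 = gradedIdentities ℬ

/-- A `T_ℤ`-ideal: a two-sided ideal which is invariant under all graded endomorphisms. -/
def IsTIdeal (I : TwoSidedIdeal (FreeGr F)) : Prop :=
  ∀ φ : FreeGr F →ₐ[F] FreeGr F,
    (∀ i, ∀ f ∈ freeComponent F i, φ f ∈ freeComponent F i) → ∀ f ∈ I, φ f ∈ I

/-- The `T_ℤ`-ideal generated by a set of polynomials. -/
def tIdealSpan (S : Set (FreeGr F)) : TwoSidedIdeal (FreeGr F) :=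
  sInf {I | IsTIdeal I ∧ ∀ f ∈ S, f ∈ I}

/-- A graded algebra generates the variety of graded algebras defined by the identities in `S` if
its ideal of graded identities is the `T_ℤ`-ideal of that variety, the one generated by `S`. -/
def GeneratesVariety (𝒜 : ℤ → Submodule F A) [GradedAlgebra 𝒜] (S : Set (FreeGr F)) : Prop :=
  gradedIdentities 𝒜 = tIdealSpan S

variable (F)

/-- The identities defining the variety `𝔙₁`: the triple commutators
`[x₁, x₂, x₃] = [[x₁, x₂], x₃]` of variables of arbitrary degrees. -/
def definingV1 : Set (FreeGr F) :=
  {f | ∃ (i j l : ℤ) (p q r : ℕ), f = ⁅⁅x F i p, x F j q⁆, x F l r⁆}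

/-- The identities defining the variety `𝔙₂`: `[x₁, x₂]` if one of the degrees is even, and
`x₁ x₂ + x₂ x₁` if both degrees are odd. -/
def definingV2 : Set (FreeGr F) :=
  {f | ∃ (i j : ℤ) (p q : ℕ), (Even i ∨ Even j) ∧ f = ⁅x F i p, x F j q⁆} ∪
  {f | ∃ (i j : ℤ) (p q : ℕ), (Odd i ∧ Odd j) ∧ f = x F i p * x F j q + x F j q * x F i p}

end Identities

/-! ### The `2`-induced gradings of the Grassmann algebra -/

section Grassmann

/-- The data of the graded algebra `E_{(m,n)}^{(u,v)}`: a decomposition `L = L_m ⊕ L_n` of a vector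
space of countably infinite dimension with `dim L_m = u` and `dim L_n = v`, given by a basis
`e₀, e₁, …` of `L` adapted to it; `deg k` is the degree of `e_k`, which is `m` if `e_k ∈ L_m` and
`n` if `e_k ∈ L_n`. -/
structure TwoInduced (F : Type*) [Field F] (L : Type*) [AddCommGroup L] [Module F L]
    (m n : ℤ) (u v : ℕ∞) where
  basis : Basis ℕ F L
  deg : ℕ → ℤ
  deg_eq : ∀ k, deg k = m ∨ deg k = n
  encard_left : {k | deg k = m}.encard = u
  encard_right : {k | deg k = n}.encard = v

variable {F : Type*} [Field F] {L : Type*} [AddCommGroup L] [Module F L]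
  {m n : ℤ} {u v : ℕ∞}

namespace TwoInduced

/-- The basis monomial `e_{i₁} ⋯ e_{i_k}` with `s = {i₁ < ⋯ < i_k}` of the Grassmann algebra
`E` of `L`. -/
def monomial (D : TwoInduced F L m n u v) (s : Finset ℕ) : ExteriorAlgebra F L :=
  D.basis.ExteriorAlgebra s

/-- The homogeneous component of degree `r`: the span of the basis monomials
`e_{i₁} ⋯ e_{i_k}` with `‖e_{i₁}‖ + ⋯ + ‖e_{i_k}‖ = r`. -/
def component (D : TwoInduced F L m n u v) (r : ℤ) : Submodule F (ExteriorAlgebra F L) :=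
  Submodule.span F (D.monomial '' {s | ∑ i ∈ s, D.deg i = r})

theorem monomial_mem (D : TwoInduced F L m n u v) (s : Finset ℕ) :
    D.monomial s ∈ D.component (∑ i ∈ s, D.deg i) :=
  Submodule.subset_span ⟨s, rfl, rfl⟩

theorem monomial_mul_mem (D : TwoInduced F L m n u v) (s t : Finset ℕ) :
    D.monomial s * D.monomial t ∈ D.component (∑ i ∈ s, D.deg i + ∑ i ∈ t, D.deg i) := by
  by_cases h : Disjoint s t
  · have e := ExteriorAlgebra.basis_mul_of_disjoint D.basis
      (⟨s, rfl⟩ : Set.powersetCard ℕ s.card) (⟨t, rfl⟩ : Set.powersetCard ℕ t.card) h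
    unfold monomial
    rw [e, ← Finset.sum_union h]
    have hm := D.monomial_mem (s ∪ t)
    rw [Units.smul_def]
    exact zsmul_mem (by simpa [monomial, Set.powersetCard.disjUnion] using hm) _
  · have e := ExteriorAlgebra.basis_mul_of_not_disjoint D.basis
      (⟨s, rfl⟩ : Set.powersetCard ℕ s.card) (⟨t, rfl⟩ : Set.powersetCard ℕ t.card) h
    unfold monomial
    rw [e]
    exact zero_mem _

instance gradedMonoid (D : TwoInduced F L m n u v) : SetLike.GradedMonoid D.component where
  one_mem := by
    have h := D.monomial_mem ∅
    have e : D.monomial ∅ = 1 := by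
      simp [monomial, ExteriorAlgebra.basis_apply_ofCard (n := 0) D.basis Finset.card_empty]
    simpa [e] using h
  mul_mem := by
    intro i j a b ha hb
    unfold component at ha hb
    induction ha, hb using Submodule.span_induction₂ with
    | mem_mem a b ha hb =>
      obtain ⟨s, rfl, rfl⟩ := ha
      obtain ⟨t, rfl, rfl⟩ := hb
      exact D.monomial_mul_mem s t
    | zero_left => simp
    | zero_right => simp
    | add_left _ _ _ _ _ _ h1 h2 => rw [add_mul]; exact add_mem h1 h2
    | add_right _ _ _ _ _ _ h1 h2 => rw [mul_add]; exact add_mem h1 h2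
    | smul_left c _ _ _ _ h => rw [smul_mul_assoc]; exact Submodule.smul_mem _ _ h
    | smul_right c _ _ _ _ h => rw [mul_smul_comm]; exact Submodule.smul_mem _ _ h

/-- The linear map sending each basis monomial to itself, placed in its degree. -/
def decomposeMap (D : TwoInduced F L m n u v) :
    ExteriorAlgebra F L →ₗ[F] DirectSum ℤ fun r => D.component r :=
  D.basis.ExteriorAlgebra.constr F fun s =>
    DirectSum.lof F ℤ (fun r => D.component r) (∑ i ∈ s, D.deg i) ⟨D.monomial s, D.monomial_mem s⟩

theorem decomposeMap_monomial (D : TwoInduced F L m n u v) (s : Finset ℕ) :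
    D.decomposeMap (D.monomial s) = DirectSum.lof F ℤ (fun r => D.component r)
      (∑ i ∈ s, D.deg i) ⟨D.monomial s, D.monomial_mem s⟩ := by
  simp only [decomposeMap, monomial, Basis.constr_basis]

instance decomposition (D : TwoInduced F L m n u v) : DirectSum.Decomposition D.component :=
  DirectSum.Decomposition.ofLinearMap D.component D.decomposeMap
    (by
      refine D.basis.ExteriorAlgebra.ext fun s => ?_
      have h := D.decomposeMap_monomial s
      unfold monomial at h
      simp [h])
    (by
      ext r ⟨y, hy⟩ : 2
      simp only [LinearMap.comp_apply, DirectSum.coeLinearMap_lof, LinearMap.id_apply]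
      unfold component at hy
      induction hy using Submodule.span_induction with
      | mem y hy =>
        obtain ⟨s, rfl, rfl⟩ := hy
        exact D.decomposeMap_monomial s
      | zero => rw [map_zero]; exact (map_zero _).symm
      | add y z hy hz h1 h2 => rw [map_add, h1, h2, ← map_add]; rfl
      | smul c y hy h => rw [map_smul, h, ← map_smul]; rfl)

/-- The Grassmann algebra with these components is a `ℤ`-graded algebra. -/
instance gradedAlgebra (D : TwoInduced F L m n u v) : GradedAlgebra D.component where

/-- The support of the grading. -/
def support (D : TwoInduced F L m n u v) : Set ℤ := {r | D.component r ≠ ⊥}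

end TwoInduced

end Grassmann

end

end GradedGrassmann

namespace GradedGrassmann

/-! ### Commutation rules and products of basis monomials -/

section Parity

variable {F L : Type*} [Field F] [AddCommGroup L] [Module F L]

/-! Basis monomials of even length are central and those of odd length anticommute, so the
identities depend only on which length parities occur in each degree. Since `m` and `n` are coprime
of opposite signs, every degree has the form `a * m + b * n` with `a, b` natural, and since both
summands of `L` are infinite-dimensional, such monomials exist away from any finite set of indices.
If `m * n` is odd, length and degree have the same parity (`odd_card_iff`): even components are
central and odd ones anticommute. If `m * n` is even, exactly one of `m`, `n` is even, and replacing
`(a, b)` by `(a + n, b - m)` keeps the degree but flips the length parity. Every component then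
contains both kinds of monomials (`exists_finset_of_degree_of_parity`), and only the triple
commutator identity of the ungraded Grassmann algebra survives.

That the defining polynomials are identities is checked on monomials. The converse is
`le_of_separating`. Normal forms span the free algebra modulo the defining identities
(`prod_mul_pairComm_mem_span`, `prod_mem_span_of_commute_up_to_sign`). For each normal form, a
substitution from `exists_generic` is nonzero on it and kills every other normal form that is not
smaller in a suitable order; hence the least term of a nontrivial combination would survive, and no
such combination is an identity.

Thus the ideal of identities depends only on the parity of `m * n`, which gives the equivalences.
The commutator of two variables of degree `0` tells the two cases apart. -/

theorem ι_mul_ι_prod (v : L) (l : List L) :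
    ExteriorAlgebra.ι F v * (l.map (ExteriorAlgebra.ι F)).prod =
      (-1) ^ l.length * ((l.map (ExteriorAlgebra.ι F)).prod * ExteriorAlgebra.ι F v) := by
  induction l with
  | nil => simp
  | cons w l ih =>
    have h : ExteriorAlgebra.ι F v * ExteriorAlgebra.ι F w =
        -(ExteriorAlgebra.ι F w * ExteriorAlgebra.ι F v) :=
      eq_neg_of_add_eq_zero_left (ExteriorAlgebra.ι_add_mul_swap v w)
    have hc : Commute (ExteriorAlgebra.ι F w) ((-1) ^ l.length) :=
      ((Commute.neg_one_right _).pow_right _)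
    rw [List.map_cons, List.prod_cons, ← mul_assoc, h, neg_mul, mul_assoc, ih, ← mul_assoc, hc.eq,
      List.length_cons, pow_succ]
    noncomm_ring

theorem ι_prod_mul_ι_prod (k l : List L) :
    (k.map (ExteriorAlgebra.ι F)).prod * (l.map (ExteriorAlgebra.ι F)).prod =
      (-1) ^ (k.length * l.length) *
        ((l.map (ExteriorAlgebra.ι F)).prod * (k.map (ExteriorAlgebra.ι F)).prod) := by
  induction k with
  | nil => simp
  | cons v k ih =>
    have hc : Commute (ExteriorAlgebra.ι F v) ((-1) ^ (k.length * l.length)) :=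
      ((Commute.neg_one_right _).pow_right _)
    rw [List.map_cons, List.prod_cons, mul_assoc, ih, ← mul_assoc, hc.eq, mul_assoc,
      ← mul_assoc (ExteriorAlgebra.ι F v), ι_mul_ι_prod, List.length_cons, add_mul, one_mul,
      pow_add]
    simp only [mul_assoc]

variable {m n : ℤ} {u v : ℕ∞}

namespace TwoInduced

theorem monomial_eq_ι_prod (D : TwoInduced F L m n u v) (s : Finset ℕ) :
    ∃ l : List L, l.length = s.card ∧ D.monomial s = (l.map (ExteriorAlgebra.ι F)).prod := by
  unfold monomial
  rw [ExteriorAlgebra.basis_apply]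
  refine ⟨List.ofFn (D.basis ∘
      Set.powersetCard.ofFinEmbEquiv.symm (Set.powersetCard.prodEquiv.symm s).snd),
    List.length_ofFn, (ExteriorAlgebra.ιMulti_apply _).trans ?_⟩
  rw [List.map_ofFn]
  rfl

theorem monomial_mul_monomial (D : TwoInduced F L m n u v) (s t : Finset ℕ) :
    D.monomial s * D.monomial t = (-1) ^ (s.card * t.card) * (D.monomial t * D.monomial s) := by
  obtain ⟨k, hk, h⟩ := D.monomial_eq_ι_prod s
  obtain ⟨l, hl, h'⟩ := D.monomial_eq_ι_prod t
  rw [h, h', ← hk, ← hl, ι_prod_mul_ι_prod]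

theorem monomial_ne_zero (D : TwoInduced F L m n u v) (s : Finset ℕ) : D.monomial s ≠ 0 :=
  D.basis.ExteriorAlgebra.ne_zero s

theorem monomial_empty (D : TwoInduced F L m n u v) : D.monomial ∅ = 1 := by
  simp [monomial, ExteriorAlgebra.basis_apply_ofCard (n := 0) D.basis Finset.card_empty]

theorem exists_monomial_mul (D : TwoInduced F L m n u v) {s t : Finset ℕ} (h : Disjoint s t) :
    ∃ ε : ℤˣ, D.monomial s * D.monomial t = ε • D.monomial (s ∪ t) := by
  have e := ExteriorAlgebra.basis_mul_of_disjoint D.basis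
      (⟨s, rfl⟩ : Set.powersetCard ℕ s.card) (⟨t, rfl⟩ : Set.powersetCard ℕ t.card) h
  exact ⟨_, e.trans (by simp [monomial, Set.powersetCard.disjUnion]; rfl)⟩

theorem span_monomial (D : TwoInduced F L m n u v) :
    Submodule.span F (Set.range D.monomial) = ⊤ :=
  D.basis.ExteriorAlgebra.span_eq

theorem monomial_commute (D : TwoInduced F L m n u v) {s : Finset ℕ} (hs : Even s.card)
    (a : ExteriorAlgebra F L) : Commute (D.monomial s) a := by
  have ha : a ∈ Submodule.span F (Set.range D.monomial) := D.span_monomial ▸ Submodule.mem_top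
  induction ha using Submodule.span_induction with
  | mem a ha =>
    obtain ⟨t, rfl⟩ := ha
    rw [Commute, SemiconjBy, monomial_mul_monomial, (hs.mul_right _).neg_one_pow, one_mul]
  | zero => exact Commute.zero_right _
  | add _ _ _ _ h h' => exact h.add_right h'
  | smul c _ _ h => exact h.smul_right c

theorem monomial_mem_center (D : TwoInduced F L m n u v) {s : Finset ℕ} (hs : Even s.card) :
    D.monomial s ∈ Subalgebra.center F (ExteriorAlgebra F L) :=
  Subalgebra.mem_center_iff.2 fun a => (D.monomial_commute hs a).eq.symm

theorem monomial_mul_monomial_of_odd (D : TwoInduced F L m n u v) {s t : Finset ℕ}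
    (hs : Odd s.card) (ht : Odd t.card) :
    D.monomial s * D.monomial t = -(D.monomial t * D.monomial s) := by
  rw [monomial_mul_monomial, (hs.mul ht).neg_one_pow, neg_one_mul]

theorem monomial_mul_self (D : TwoInduced F L m n u v) {s : Finset ℕ} (hs : s.Nonempty) :
    D.monomial s * D.monomial s = 0 :=
  ExteriorAlgebra.basis_mul_of_not_disjoint D.basis
    (⟨s, rfl⟩ : Set.powersetCard ℕ s.card) (⟨s, rfl⟩ : Set.powersetCard ℕ s.card)
    (by simpa using hs.ne_empty)

theorem exists_prod_monomial {ι : Type*} [DecidableEq ι] (D : TwoInduced F L m n u v) (S : ι → Finset ℕ)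
    (hS : Pairwise fun i j => Disjoint (S i) (S j)) (l : List ι) (hl : l.Nodup) :
    ∃ ε : ℤˣ, (l.map fun i => D.monomial (S i)).prod = ε • D.monomial (l.toFinset.biUnion S) := by
  induction l with
  | nil => exact ⟨1, by simp [monomial_empty]⟩
  | cons i l ih =>
    obtain ⟨hi, hl⟩ := List.nodup_cons.1 hl
    obtain ⟨ε, h⟩ := ih hl
    obtain ⟨δ, h'⟩ := D.exists_monomial_mul (s := S i) (t := l.toFinset.biUnion S)
      ((Finset.disjoint_biUnion_right _ _ _).2 fun j hj =>
        hS fun e => hi (by simpa [e] using hj))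
    refine ⟨ε * δ, ?_⟩
    rw [List.map_cons, List.prod_cons, h, List.toFinset_cons, Finset.biUnion_insert,
      mul_smul_comm, h', smul_smul]

/-- Up to sign the product is the basis monomial on the union of the supports. This is the source of
nonvanishing for the generic substitutions. -/
theorem prod_monomial_ne_zero {ι : Type*} (D : TwoInduced F L m n u v) (S : ι → Finset ℕ)
    (hS : Pairwise fun i j => Disjoint (S i) (S j)) (l : List ι) (hl : l.Nodup) :
    (l.map fun i => D.monomial (S i)).prod ≠ 0 := by
  classical
  obtain ⟨ε, h⟩ := D.exists_prod_monomial S hS l hl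
  rw [h]
  exact (smul_ne_zero_iff_ne ε).2 (D.monomial_ne_zero _)

/-- By bilinearity only two monomials of odd length matter; their product is zero or, up to sign, a
monomial of even length. -/
theorem commutator_mem_center (D : TwoInduced F L m n u v) (a b : ExteriorAlgebra F L) :
    a * b - b * a ∈ Subalgebra.center F (ExteriorAlgebra F L) := by
  have ha : a ∈ Submodule.span F (Set.range D.monomial) := D.span_monomial ▸ Submodule.mem_top
  have hb : b ∈ Submodule.span F (Set.range D.monomial) := D.span_monomial ▸ Submodule.mem_top
  induction ha, hb using Submodule.span_induction₂ with
  | mem_mem a b ha hb =>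
    obtain ⟨s, rfl⟩ := ha
    obtain ⟨t, rfl⟩ := hb
    rcases Nat.even_or_odd s.card with hs | hs
    · rw [(D.monomial_commute hs _).eq, sub_self]
      exact zero_mem _
    rcases Nat.even_or_odd t.card with ht | ht
    · rw [(D.monomial_commute ht _).eq, sub_self]
      exact zero_mem _
    by_cases hst : Disjoint s t
    · obtain ⟨ε, h⟩ := D.exists_monomial_mul hst
      have hm : D.monomial (s ∪ t) ∈ Subalgebra.center F (ExteriorAlgebra F L) :=
        D.monomial_mem_center (by rw [Finset.card_union_of_disjoint hst]; exact hs.add_odd ht)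
      rw [D.monomial_mul_monomial_of_odd ht hs, h, Units.smul_def]
      exact sub_mem (zsmul_mem hm _) (neg_mem (zsmul_mem hm _))
    · have h : ∀ s t : Finset ℕ, ¬ Disjoint s t → D.monomial s * D.monomial t = 0 :=
        fun s t h => ExteriorAlgebra.basis_mul_of_not_disjoint D.basis
          (⟨s, rfl⟩ : Set.powersetCard ℕ s.card) (⟨t, rfl⟩ : Set.powersetCard ℕ t.card) h
      rw [h s t hst, h t s (fun h => hst h.symm), sub_self]
      exact zero_mem _
  | zero_left => simp
  | zero_right => simp
  | add_left x y z _ _ _ h1 h2 =>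
    rw [show (x + y) * z - z * (x + y) = (x * z - z * x) + (y * z - z * y) by noncomm_ring]
    exact add_mem h1 h2
  | add_right x y z _ _ _ h1 h2 =>
    rw [show x * (y + z) - (y + z) * x = (x * y - y * x) + (x * z - z * x) by noncomm_ring]
    exact add_mem h1 h2
  | smul_left c _ _ _ _ h =>
    rw [smul_mul_assoc, mul_smul_comm, ← smul_sub]; exact Subalgebra.smul_mem _ h c
  | smul_right c _ _ _ _ h =>
    rw [smul_mul_assoc, mul_smul_comm, ← smul_sub]; exact Subalgebra.smul_mem _ h c

end TwoInduced

end Parity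

/-! ### Monomials of prescribed degree and length parity -/

section Degrees

variable {F L : Type*} [Field F] [AddCommGroup L] [Module F L] {m n : ℤ}

namespace TwoInduced

theorem exists_disjoint_finset (D : TwoInduced F L m n ⊤ ⊤) (hmn : m ≠ n) (U : Finset ℕ)
    (a b : ℕ) : ∃ s : Finset ℕ, Disjoint U s ∧ s.card = a + b ∧ ∑ i ∈ s, D.deg i = a * m + b * n := by
  have hm : ({k | D.deg k = m} \ (U : Set ℕ)).Infinite :=
    (Set.encard_eq_top_iff.1 D.encard_left).sdiff U.finite_toSet
  have hn : ({k | D.deg k = n} \ (U : Set ℕ)).Infinite :=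
    (Set.encard_eq_top_iff.1 D.encard_right).sdiff U.finite_toSet
  obtain ⟨s, hs, hsa⟩ := hm.exists_subset_card_eq a
  obtain ⟨t, ht, htb⟩ := hn.exists_subset_card_eq b
  have hs' : ∀ k ∈ s, D.deg k = m := fun k hk => (hs hk).1
  have ht' : ∀ k ∈ t, D.deg k = n := fun k hk => (ht hk).1
  have hst : Disjoint s t := Finset.disjoint_left.2 fun k hk hk' =>
    hmn ((hs' k hk).symm.trans (ht' k hk'))
  refine ⟨s ∪ t, ?_, ?_, ?_⟩
  · rw [Finset.disjoint_union_right]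
    exact ⟨Finset.disjoint_right.2 fun k hk => (hs hk).2,
      Finset.disjoint_right.2 fun k hk => (ht hk).2⟩
  · rw [Finset.card_union_of_disjoint hst, hsa, htb]
  · rw [Finset.sum_union hst, Finset.sum_congr rfl hs', Finset.sum_congr rfl ht']
    simp [hsa, htb]

/-- Bézout coefficients can be shifted by multiples of `(n, -m)`, both of whose entries are
positive. Positivity of `a` keeps the resulting monomial different from `1`, so that its square is
zero. -/
theorem exists_nat_combination (hm : m < 0) (hn : 0 < n) (hmn : Int.gcd m n = 1) (r : ℤ) :
    ∃ a b : ℕ, 0 < a ∧ (a * m + b * n : ℤ) = r := by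
  have h := Int.gcd_eq_gcd_ab m n
  rw [hmn] at h
  set p := r * Int.gcdA m n
  set q := r * Int.gcdB m n
  have hpq : p * m + q * n = r := by
    simp only [p, q]; push_cast at h; linear_combination (-r) * h
  -- The multiple `|p| + |q| + 1` outweighs both coefficients because `n` and `-m` are at least `1`.
  have hp : 0 < p + (|p| + |q| + 1) * n := by
    nlinarith [neg_abs_le p, abs_nonneg p, abs_nonneg q]
  have hq : 0 ≤ q + (|p| + |q| + 1) * (-m) := by
    nlinarith [neg_abs_le q, abs_nonneg p, abs_nonneg q]
  refine ⟨(p + (|p| + |q| + 1) * n).toNat, (q + (|p| + |q| + 1) * (-m)).toNat,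
    Int.pos_iff_toNat_pos.1 hp, ?_⟩
  rw [Int.toNat_of_nonneg hp.le, Int.toNat_of_nonneg hq]
  linear_combination hpq

theorem exists_finset_of_degree (D : TwoInduced F L m n ⊤ ⊤) (hm : m < 0) (hn : 0 < n)
    (hmn : Int.gcd m n = 1) (U : Finset ℕ) (r : ℤ) :
    ∃ s : Finset ℕ, Disjoint U s ∧ s.Nonempty ∧ ∑ i ∈ s, D.deg i = r := by
  obtain ⟨a, b, ha, rfl⟩ := exists_nat_combination hm hn hmn r
  obtain ⟨s, hs, hc, h⟩ := D.exists_disjoint_finset (hm.trans hn).ne U a b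
  exact ⟨s, hs, Finset.card_pos.1 (by omega), h⟩

/-- Every generator has odd degree, so each factor flips both parities. -/
theorem odd_card_iff (D : TwoInduced F L m n ⊤ ⊤) (hmn : Odd (m * n)) (s : Finset ℕ) :
    Odd s.card ↔ Odd (∑ i ∈ s, D.deg i) := by
  obtain ⟨h1, h2⟩ := Int.odd_mul.1 hmn
  induction s using Finset.induction_on with
  | empty => simp
  | insert a s ha ih =>
    have hd : Odd (D.deg a) := by rcases D.deg_eq a with h | h <;> rwa [h]
    rw [Finset.sum_insert ha, Finset.card_insert_of_notMem ha, Nat.odd_add_one, ih, Int.odd_add,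
      ← Int.not_odd_iff_even]
    tauto

theorem exists_finset_of_degree_of_parity (D : TwoInduced F L m n ⊤ ⊤) (hm : m < 0) (hn : 0 < n)
    (hmn : Int.gcd m n = 1) (he : Even (m * n)) (U : Finset ℕ) (r : ℤ) :
    (∃ s : Finset ℕ, Disjoint U s ∧ s.Nonempty ∧ ∑ i ∈ s, D.deg i = r ∧ Even s.card) ∧
    ∃ s : Finset ℕ, Disjoint U s ∧ s.Nonempty ∧ ∑ i ∈ s, D.deg i = r ∧ Odd s.card := by
  obtain ⟨a, b, ha, h⟩ := exists_nat_combination hm hn hmn r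
  obtain ⟨s, hs, hsc, hsd⟩ := D.exists_disjoint_finset (hm.trans hn).ne U a b
  obtain ⟨t, ht, htc, htd⟩ :=
    D.exists_disjoint_finset (hm.trans hn).ne U (a + n.toNat) (b + (-m).toNat)
  -- The shift by `(n, -m)` adds `n - m` factors, an odd number because coprimality excludes that
  -- `m` and `n` are both even.
  have hpar : Odd (n.toNat + (-m).toNat) := by
    have hno : ¬ (Even m ∧ Even n) := by
      rintro ⟨h1, h2⟩
      have := Int.dvd_coe_gcd h1.two_dvd h2.two_dvd
      rw [hmn] at this
      norm_num at this
    have := Int.even_mul.1 he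
    simp only [Int.even_iff, Nat.odd_iff] at *
    omega
  have hd : ∑ i ∈ t, D.deg i = r := by
    rw [htd, ← h]
    push_cast
    rw [Int.toNat_of_nonneg hn.le, Int.toNat_of_nonneg (by omega)]
    ring
  have hs0 : s.Nonempty := Finset.card_pos.1 (by omega)
  have ht0 : t.Nonempty := Finset.card_pos.1 (by omega)
  rcases Nat.even_or_odd s.card with hp | hp
  · refine ⟨⟨s, hs, hs0, hsd.trans h, hp⟩, t, ht, ht0, hd, ?_⟩
    rw [hsc] at hp
    rw [htc, add_add_add_comm]
    exact hp.add_odd hpar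
  · refine ⟨⟨t, ht, ht0, hd, ?_⟩, s, hs, hs0, hsd.trans h, hp⟩
    rw [hsc] at hp
    rw [htc, add_add_add_comm]
    exact hp.add_odd hpar

end TwoInduced

/-- Greedy choice: each new set avoids the union of the earlier ones. The value `∅` outside `P`
makes disjointness hold on the whole index type. -/
theorem exists_disjoint_family {ι : Type*} (Q : ι → Finset ℕ → Prop) (P : Finset ι)
    (hQ : ∀ i ∈ P, ∀ U : Finset ℕ, ∃ s, Disjoint U s ∧ Q i s) :
    ∃ S : ι → Finset ℕ, (∀ i ∈ P, Q i (S i)) ∧ (∀ i ∉ P, S i = ∅) ∧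
      Pairwise fun i j => Disjoint (S i) (S j) := by
  classical
  induction P using Finset.induction_on with
  | empty => exact ⟨fun _ => ∅, by simp, by simp, fun i j _ => Finset.disjoint_empty_left _⟩
  | insert a P ha ih =>
    obtain ⟨S, h1, h2, h3⟩ := ih fun i hi => hQ i (Finset.mem_insert_of_mem hi)
    obtain ⟨s, hs, hs'⟩ := hQ a (Finset.mem_insert_self a P) (P.biUnion S)
    have key : ∀ j ≠ a, Disjoint (S j) s := fun j _ => by
      by_cases hj : j ∈ P
      · exact (Finset.disjoint_biUnion_left _ _ _).1 hs j hj
      · rw [h2 j hj]; exact Finset.disjoint_empty_left _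
    refine ⟨Function.update S a s, fun i hi => ?_, fun i hi => ?_, fun i j hij => ?_⟩
    · rcases eq_or_ne i a with rfl | hne
      · simpa using hs'
      · rw [Function.update_of_ne hne]
        exact h1 i ((Finset.mem_insert.1 hi).resolve_left hne)
    · rw [Finset.mem_insert, not_or] at hi
      rw [Function.update_of_ne hi.1, h2 i hi.2]
    · rcases eq_or_ne i a with rfl | hi
      · simpa [hij.symm] using (key j hij.symm).symm
      · rcases eq_or_ne j a with rfl | hj
        · simpa [hi] using key i hi
        · simpa [hi, hj] using h3 hij

end Degrees

end GradedGrassmann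
namespace GradedGrassmann

noncomputable section

/-! ### Normal forms when all commutators are central -/

section PairCommutator

variable {X F R : Type*} [Field F] [Ring R] [Algebra F R]

/-- The product `[a₁, a₂] [a₃, a₄] ⋯` of the commutators of consecutive pairs in a list, which is
zero if the list has odd length. -/
def pairComm : List R → R
  | [] => 1
  | [_] => 0
  | a :: b :: l => (a * b - b * a) * pairComm l

theorem pairComm_of_odd : ∀ l : List R, Odd l.length → pairComm l = 0
  | [], h => by simp at h
  | [_], _ => rfl
  | _ :: _ :: l, h => by
    rw [pairComm, pairComm_of_odd l (by simpa [Nat.odd_add_one] using h), mul_zero]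

theorem map_pairComm {S : Type*} [Ring S] [Algebra F S] (φ : R →ₐ[F] S) :
    ∀ l : List R, φ (pairComm l) = pairComm (l.map φ)
  | [] => map_one φ
  | [_] => map_zero φ
  | a :: b :: l => by
    simp only [pairComm, List.map_cons, map_mul, map_sub, map_pairComm φ l]

/-- Expand `[[ab, c], d]` by the Leibniz rule: all triple commutators vanish, leaving `[a, d][b, c]
+ [a, c][b, d] = 0`. -/
theorem comm_mul_comm (H : ∀ a b c : R, Commute (a * b - b * a) c) (a b c d : R) :
    (a * d - d * a) * (b * c - c * b) = -((a * c - c * a) * (b * d - d * b)) := by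
  rw [eq_neg_iff_add_eq_zero]
  have h1 := sub_eq_zero.2 (H (a * b) c d).eq
  have h2 := sub_eq_zero.2 (H b c d).eq
  have h3 := sub_eq_zero.2 (H a c d).eq
  calc _ = ((a * b * c - c * (a * b)) * d - d * (a * b * c - c * (a * b)))
        - a * ((b * c - c * b) * d - d * (b * c - c * b))
        - ((a * c - c * a) * d - d * (a * c - c * a)) * b := by noncomm_ring
    _ = 0 := by rw [h1, h2, h3]; simp

theorem pairComm_commute (H : ∀ a b c : R, Commute (a * b - b * a) c) (c : R) :
    ∀ l : List R, Commute (pairComm l) c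
  | [] => Commute.one_left c
  | [_] => Commute.zero_left c
  | a :: b :: l => (H a b c).mul_left (pairComm_commute H c l)

/-- The parity of the prefix decides whether the swap lies inside one commutator, where it is
antisymmetry, or straddles two, where it is `comm_mul_comm`. -/
theorem pairComm_swap (H : ∀ a b c : R, Commute (a * b - b * a) c) (x y : R) (l : List R) :
    ∀ p : List R, pairComm (p ++ x :: y :: l) = -pairComm (p ++ y :: x :: l)
  | [] => by simp only [List.nil_append, pairComm]; noncomm_ring
  | [a] => by
    cases l with
    | nil => simp [pairComm]
    | cons b l =>
      simp only [List.cons_append, List.nil_append, pairComm, ← mul_assoc]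
      rw [← neg_mul]
      congr 1
      rw [← neg_sub (b * y), mul_neg, comm_mul_comm H a b y x]
      noncomm_ring
  | a :: b :: p => by
    simp only [List.cons_append, pairComm, pairComm_swap H x y l p, mul_neg]

theorem pairComm_perm (H : ∀ a b c : R, Commute (a * b - b * a) c) {l k : List R} (h : l.Perm k) :
    ∀ p : List R, ∃ ε : ℤˣ, pairComm (p ++ l) = ε • pairComm (p ++ k) := by
  induction h with
  | nil => exact fun p => ⟨1, (one_smul _ _).symm⟩
  | cons a _ ih => exact fun p => by simpa using ih (p ++ [a])
  | swap x y l => exact fun p => ⟨-1, by rw [pairComm_swap H, Units.neg_smul, one_smul]⟩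
  | trans _ _ ih ih' =>
    intro p
    obtain ⟨ε, h⟩ := ih p
    obtain ⟨δ, h'⟩ := ih' p
    exact ⟨ε * δ, by rw [h, h', smul_smul]⟩

theorem exists_perm_of_not_nodup {l : List X} (h : ¬ l.Nodup) :
    ∃ (x : X) (k : List X), l.Perm (x :: x :: k) := by
  obtain ⟨x, hx⟩ := List.exists_duplicate_iff_not_nodup.2 h
  obtain ⟨k, hk⟩ := (List.duplicate_iff_sublist.1 hx).exists_perm_append
  exact ⟨x, k, hk⟩

theorem pairComm_of_not_nodup (H : ∀ a b c : R, Commute (a * b - b * a) c) (g : X → R)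
    {l : List X} (h : ¬ l.Nodup) : pairComm (l.map g) = 0 := by
  obtain ⟨x, k, hk⟩ := exists_perm_of_not_nodup h
  obtain ⟨ε, e⟩ := pairComm_perm H (hk.map g) []
  rw [List.nil_append] at e
  rw [e]
  simp [pairComm]

/-- In an algebra all of whose commutators are central, the products of the generators are
combinations of products of one monomial for each multiset and one product of commutators for each
finite set of even cardinality. -/
theorem prod_mul_pairComm_mem_span (H : ∀ a b c : R, Commute (a * b - b * a) c) (g : X → R)
    (l t : List X) : (l.map g).prod * pairComm (t.map g) ∈ Submodule.span F
      (Set.range fun i : Multiset X × {T : Finset X // Even T.card} =>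
        (i.1.toList.map g).prod * pairComm (i.2.1.toList.map g)) := by
  classical
  set N := Submodule.span F (Set.range fun i : Multiset X × {T : Finset X // Even T.card} =>
        (i.1.toList.map g).prod * pairComm (i.2.1.toList.map g))
  induction hr : l.length using Nat.strong_induction_on generalizing l t with
  | _ r ih =>
    -- Swapping two adjacent letters costs a central commutator. It moves into the `pairComm` factor
    -- and leaves a word two letters shorter, to which the induction hypothesis applies.
    have key : ∀ {l k : List X}, l.Perm k → ∀ p : List X, (p ++ l).length ≤ r →
        ((p ++ l).map g).prod * pairComm (t.map g) -
          ((p ++ k).map g).prod * pairComm (t.map g) ∈ N := by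
      intro l k h
      induction h with
      | nil => intro p _; simp
      | cons a _ ih => intro p hp; simpa using ih (p ++ [a]) (by simpa using hp)
      | swap x y l =>
        intro p hp
        have h1 := ih _ (by simp at hp ⊢; omega) (p ++ l) (y :: x :: t) rfl
        convert h1 using 1
        have hc := (H (g y) (g x) (l.map g).prod).eq
        simp only [List.map_append, List.map_cons, List.prod_append, List.prod_cons, pairComm]
        rw [← mul_assoc _ (g y * g x - g x * g y), mul_assoc _ (l.map g).prod, ← hc]
        noncomm_ring
      | trans h _ ih ih' =>
        intro p hp
        have := add_mem (ih p hp) (ih' p (by simpa [h.length_eq] using hp))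
        simpa using this
    have h1 := key (Multiset.coe_eq_coe.1 (Multiset.coe_toList (l : Multiset X)).symm) []
      (by simpa using hr.le)
    refine (Submodule.sub_mem_iff_left N ?_).1 h1
    by_cases ht : t.Nodup
    · rcases Nat.even_or_odd t.length with he | ho
      · obtain ⟨ε, e⟩ := pairComm_perm H
          ((List.toFinset_toList ht).symm.map g) []
        rw [List.nil_append, List.nil_append] at e
        rw [e, mul_smul_comm, Units.smul_def]
        refine zsmul_mem (Submodule.subset_span ?_) _
        exact ⟨(l, ⟨t.toFinset, by rwa [List.toFinset_card_of_nodup ht]⟩), rfl⟩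
      · rw [pairComm_of_odd _ (by simpa using ho), mul_zero]
        exact zero_mem _
    · rw [pairComm_of_not_nodup H g ht, mul_zero]
      exact zero_mem _

end PairCommutator

/-! ### Normal forms when generators commute up to sign -/

section SuperCommutative

variable {X F R : Type*} [Field F] [Ring R] [Algebra F R]

theorem prod_perm_of_commute_up_to_sign (g : X → R)
    (hg : ∀ x y, ∃ ε : ℤˣ, g x * g y = ε • (g y * g x)) {l k : List X} (h : l.Perm k) :
    ∃ ε : ℤˣ, (l.map g).prod = ε • (k.map g).prod := by
  induction h with
  | nil => exact ⟨1, (one_smul _ _).symm⟩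
  | cons a _ ih =>
    obtain ⟨ε, e⟩ := ih
    exact ⟨ε, by simp [e, mul_smul_comm]⟩
  | swap x y l =>
    obtain ⟨ε, e⟩ := hg y x
    exact ⟨ε, by simp only [List.map_cons, List.prod_cons, ← mul_assoc, e, smul_mul_assoc]⟩
  | trans _ _ ih ih' =>
    obtain ⟨ε, h⟩ := ih
    obtain ⟨δ, h'⟩ := ih'
    exact ⟨ε * δ, by rw [h, h', smul_smul]⟩

theorem prod_mem_span_of_commute_up_to_sign [DecidableEq X] (g : X → R)
    (hg : ∀ x y, ∃ ε : ℤˣ, g x * g y = ε • (g y * g x)) (odd : X → Prop)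
    (hodd : ∀ x, odd x → g x * g x = 0) (l : List X) :
    (l.map g).prod ∈ Submodule.span F
      (Set.range fun s : {s : Multiset X // ∀ x, odd x → s.count x ≤ 1} =>
        (s.1.toList.map g).prod) := by
  by_cases h : ∀ x, odd x → (l : Multiset X).count x ≤ 1
  · obtain ⟨ε, e⟩ := prod_perm_of_commute_up_to_sign g hg
      (Multiset.coe_eq_coe.1 (Multiset.coe_toList (l : Multiset X)).symm)
    rw [e, Units.smul_def]
    refine zsmul_mem (Submodule.subset_span ?_) _
    exact ⟨⟨l, h⟩, rfl⟩
  · push Not at h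
    obtain ⟨x, hx, hc⟩ := h
    obtain ⟨k, hk⟩ := (List.duplicate_iff_sublist.1
      (List.duplicate_iff_two_le_count.2 (by simpa [Nat.succ_le_iff] using hc))).exists_perm_append
    obtain ⟨ε, e⟩ := prod_perm_of_commute_up_to_sign g hg hk
    rw [e]
    simp [← mul_assoc, hodd x hx]

end SuperCommutative

/-! ### Comparing two-sided ideals by triangular separation -/

section Separation

variable {X F : Type*} [Field F]

theorem mem_span_words (f : FreeAlgebra F X) : f ∈ Submodule.span F
    (Set.range fun l : List X => (l.map (FreeAlgebra.ι F)).prod) := by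
  induction f using FreeAlgebra.induction with
  | grade0 r =>
    rw [Algebra.algebraMap_eq_smul_one]
    exact Submodule.smul_mem _ _ (Submodule.subset_span ⟨[], rfl⟩)
  | grade1 x => exact Submodule.subset_span ⟨[x], by simp⟩
  | mul a b ha hb =>
    induction ha, hb using Submodule.span_induction₂ with
    | mem_mem a b ha hb =>
      obtain ⟨k, rfl⟩ := ha
      obtain ⟨l, rfl⟩ := hb
      exact Submodule.subset_span ⟨k ++ l, by simp⟩
    | zero_left => simp
    | zero_right => simp
    | add_left _ _ _ _ _ _ h1 h2 => rw [add_mul]; exact add_mem h1 h2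
    | add_right _ _ _ _ _ _ h1 h2 => rw [mul_add]; exact add_mem h1 h2
    | smul_left c _ _ _ _ h => rw [smul_mul_assoc]; exact Submodule.smul_mem _ _ h
    | smul_right c _ _ _ _ h => rw [mul_smul_comm]; exact Submodule.smul_mem _ _ h
  | add a b ha hb => exact add_mem ha hb

/-- The quotient map by a two-sided ideal of the free algebra. -/
def quotientMap (I : TwoSidedIdeal (FreeAlgebra F X)) :
    FreeAlgebra F X →ₐ[F] I.ringCon.Quotient :=
  { I.ringCon.mk' with commutes' := fun _ => rfl }

theorem quotientMap_eq_zero_iff {I : TwoSidedIdeal (FreeAlgebra F X)} {f : FreeAlgebra F X} :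
    quotientMap I f = 0 ↔ f ∈ I :=
  (RingCon.eq I.ringCon).trans (TwoSidedIdeal.mem_iff I f).symm

theorem quotientMap_surjective (I : TwoSidedIdeal (FreeAlgebra F X)) :
    Function.Surjective (quotientMap I) :=
  I.ringCon.mk'_surjective

/-- A triangularity argument: modulo `I` an element of `J` is a combination of the `v i`, and the
map attached to a term of least `μ` isolates its coefficient. Ties in `μ` are allowed, since that
map kills the other terms of equal value too. -/
theorem le_of_separating {M : Type*} [AddCommGroup M] [Module F M] {κ : Type*} {α : Type*}
    [LinearOrder α] {I J : TwoSidedIdeal (FreeAlgebra F X)} (hIJ : I ≤ J)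
    (v : κ → FreeAlgebra F X) (μ : κ → α)
    (hspan : ∀ l : List X, (l.map fun x => quotientMap I (FreeAlgebra.ι F x)).prod ∈
      Submodule.span F (Set.range fun i => quotientMap I (v i)))
    (hsep : ∀ i, ∃ φ : FreeAlgebra F X →ₗ[F] M, (∀ f ∈ J, φ f = 0) ∧ φ (v i) ≠ 0 ∧
      ∀ j ≠ i, μ i ≤ μ j → φ (v j) = 0) : J ≤ I := by
  intro f hf
  have h1 : quotientMap I f ∈ Submodule.span F (Set.range fun i => quotientMap I (v i)) := by
    have hf' := mem_span_words f
    clear hf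
    induction hf' using Submodule.span_induction with
    | mem f hf =>
      obtain ⟨l, rfl⟩ := hf
      simpa [map_list_prod, Function.comp_def] using hspan l
    | zero => simp
    | add _ _ _ _ h h' => rw [map_add]; exact add_mem h h'
    | smul c _ _ h => rw [map_smul]; exact Submodule.smul_mem _ _ h
  obtain ⟨c, hc⟩ := Finsupp.mem_span_range_iff_exists_finsupp.1 h1
  set w := c.sum fun i a => a • v i with hw
  have hwf : quotientMap I w = quotientMap I f := by
    rw [← hc, hw, Finsupp.sum, Finsupp.sum, map_sum]
    simp only [map_smul]
  have hfw : f - w ∈ I := by rw [← quotientMap_eq_zero_iff, map_sub, hwf, sub_self]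
  have hwJ : w ∈ J := by simpa using J.sub_mem hf (hIJ hfw)
  suffices c = 0 by simpa [hw, this] using hfw
  by_contra hne
  obtain ⟨i, hi, hmin⟩ := Finset.exists_min_image c.support μ (Finsupp.support_nonempty_iff.2 hne)
  obtain ⟨φ, h0, h2, h3⟩ := hsep i
  have h4 := h0 w hwJ
  rw [hw, Finsupp.sum, map_sum, Finset.sum_eq_single_of_mem i hi, map_smul] at h4
  · exact (smul_ne_zero (Finsupp.mem_support_iff.1 hi) h2) h4
  · intro j hj hji
    rw [map_smul, h3 j hji (hmin j hj), smul_zero]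

end Separation

end

end GradedGrassmann
namespace GradedGrassmann

noncomputable section

/-! ### Powers of sums of commuting square-zero elements -/

section SquareZero

variable {C : Type*} [CommRing C]

theorem add_pow_succ_of_mul_self_eq_zero {a : C} (ha : a * a = 0) (y : C) (k : ℕ) :
    (a + y) ^ (k + 1) = y ^ (k + 1) + (k + 1) * (a * y ^ k) := by
  induction k with
  | zero => simp [add_comm]
  | succ k ih =>
    rw [pow_succ, ih]
    push_cast
    linear_combination ((k : C) + 1) * y ^ k * ha

theorem sum_pow_card_add_one_of_mul_self_eq_zero {ι : Type*} (P : Finset ι) (w : ι → C)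
    (hw : ∀ i ∈ P, w i * w i = 0) : (∑ i ∈ P, w i) ^ (P.card + 1) = 0 := by
  classical
  induction P using Finset.induction_on with
  | empty => simp
  | insert a P ha ih =>
    have h := ih fun i hi => hw i (Finset.mem_insert_of_mem hi)
    rw [Finset.sum_insert ha, add_pow_succ_of_mul_self_eq_zero (hw a (Finset.mem_insert_self a P)),
      Finset.card_insert_of_notMem ha, h, pow_succ, h]
    simp

theorem sum_pow_card_of_mul_self_eq_zero {ι : Type*} (P : Finset ι) (w : ι → C)
    (hw : ∀ i ∈ P, w i * w i = 0) :
    (∑ i ∈ P, w i) ^ P.card = (P.card.factorial : C) * ∏ i ∈ P, w i := by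
  classical
  induction P using Finset.induction_on with
  | empty => simp
  | insert a P ha ih =>
    have hw' : ∀ i ∈ P, w i * w i = 0 := fun i hi => hw i (Finset.mem_insert_of_mem hi)
    rw [Finset.sum_insert ha, Finset.card_insert_of_notMem ha,
      add_pow_succ_of_mul_self_eq_zero (hw a (Finset.mem_insert_self a P)), ih hw',
      sum_pow_card_add_one_of_mul_self_eq_zero P w hw', Finset.prod_insert ha, Nat.factorial_succ]
    push_cast
    ring

end SquareZero

/-! ### Evaluating normal forms at central and anticommuting elements -/

section Evaluation

variable {F A X : Type*} [Field F] [Ring A] [Algebra F A]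

theorem mul_prod_of_mem {Z : X → A} (hZ : ∀ x y, Z x * Z y = -(Z y * Z x))
    (hZ' : ∀ x, Z x * Z x = 0) {x : X} {t : List X} (hx : x ∈ t) : Z x * (t.map Z).prod = 0 := by
  induction t with
  | nil => simp at hx
  | cons y t ih =>
    rw [List.map_cons, List.prod_cons, ← mul_assoc]
    rcases List.mem_cons.1 hx with rfl | hx
    · rw [hZ', zero_mul]
    · rw [hZ, neg_mul, mul_assoc, ih hx, mul_zero, neg_zero]

/-- Central parts drop out of a commutator, and anticommutation gives `[Z x, Z y] = 2 * (Z x * Z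
y)`. -/
theorem pairComm_center_add (Y : X → Subalgebra.center F A) {Z : X → A}
    (hZ : ∀ x y, Z x * Z y = -(Z y * Z x)) : ∀ t : List X, Even t.length →
    ∃ k : ℕ, pairComm (t.map fun x => (Y x : A) + Z x) = 2 ^ k * (t.map Z).prod
  | [], _ => ⟨0, by simp [pairComm]⟩
  | [_], h => by simp at h
  | x :: y :: t, h => by
    obtain ⟨k, hk⟩ := pairComm_center_add Y hZ t (by simpa [Nat.even_add_one] using h)
    have hc : ∀ x a, (Y x : A) * a = a * Y x := fun x a =>
      (Subalgebra.mem_center_iff.1 (Y x).2 a).symm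
    have h2 : ((Y x : A) + Z x) * (Y y + Z y) - (Y y + Z y) * (Y x + Z x) = 2 * (Z x * Z y) := by
      rw [add_mul, mul_add, mul_add, add_mul, mul_add, mul_add, hc x (Y y), hc x (Z y),
        ← hc y (Z x), hZ y x]
      noncomm_ring
    have h3 : Commute (Z x * Z y) ((2 : A) ^ k) :=
      Commute.pow_right (Nat.cast_ofNat (R := A) (n := 2) ▸ Nat.commute_cast _ 2) k
    refine ⟨k + 1, ?_⟩
    simp only [List.map_cons, pairComm, List.prod_cons]
    rw [hk, h2, mul_assoc, ← mul_assoc (Z x * Z y), h3.eq, pow_succ']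
    simp only [mul_assoc]

theorem prod_center_add_mul (Y : X → Subalgebra.center F A) (Z : X → A) {a : A}
    (ha : ∀ x, Z x * a = 0) (l : List X) :
    (l.map fun x => (Y x : A) + Z x).prod * a = ((l.map Y).prod : Subalgebra.center F A) * a := by
  induction l with
  | nil => simp
  | cons x l ih =>
    have h := Subalgebra.mem_center_iff.1 (l.map Y).prod.2 (Z x)
    rw [List.map_cons, List.prod_cons, List.map_cons, List.prod_cons, mul_assoc, ih, add_mul,
      ← mul_assoc (Z x), h, mul_assoc _ (Z x), ha, mul_zero, add_zero, MulMemClass.coe_mul,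
      mul_assoc]

theorem prod_ite_center (p : X → Prop) [DecidablePred p] (Y : X → Subalgebra.center F A)
    (Z : X → A) (l : List X) :
    (l.map fun x => if p x then Z x else (Y x : A)).prod =
      (((l.filter fun x => ¬ p x).map Y).prod : Subalgebra.center F A) *
        ((l.filter fun x => p x).map Z).prod := by
  induction l with
  | nil => simp
  | cons x l ih =>
    rw [List.map_cons, List.prod_cons, ih]
    by_cases hx : p x
    · have h := Subalgebra.mem_center_iff.1 ((l.filter fun x => ¬ p x).map Y).prod.2 (Z x)
      simp only [hx, if_true, List.filter_cons, decide_true, not_true, decide_false,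
        Bool.false_eq_true, if_false, List.map_cons, List.prod_cons]
      rw [← mul_assoc, h, mul_assoc]
    · simp only [hx, if_true, List.filter_cons, decide_true, not_false_eq_true, decide_false,
        Bool.false_eq_true, if_false, List.map_cons, List.prod_cons, MulMemClass.coe_mul, mul_assoc]

end Evaluation

/-! ### Generic substitutions -/

section Generic

variable {F L : Type*} [Field F] [CharZero F] [AddCommGroup L] [Module F L] {m n : ℤ}

/-- Generic substitutions: central elements `Y x` whose power of exponent one more than the
multiplicity of `x` in `s` vanishes, and anticommuting elements `Z x` for `x ∈ T`, such that the
top product does not vanish. -/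
theorem TwoInduced.exists_generic (D : TwoInduced F L m n ⊤ ⊤) {X : Type*} [DecidableEq X]
    (d : X → ℤ) (s : Multiset X) (T : Finset X)
    (hs : ∀ x ∈ s, ∀ U : Finset ℕ, ∃ v, Disjoint U v ∧ v.Nonempty ∧ ∑ i ∈ v, D.deg i = d x ∧
      Even v.card)
    (hT : ∀ x ∈ T, ∀ U : Finset ℕ, ∃ v, Disjoint U v ∧ v.Nonempty ∧ ∑ i ∈ v, D.deg i = d x ∧
      Odd v.card) :
    ∃ (Y : X → Subalgebra.center F (ExteriorAlgebra F L)) (Z : X → ExteriorAlgebra F L),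
      (∀ x, (Y x : ExteriorAlgebra F L) ∈ D.component (d x)) ∧ (∀ x, Z x ∈ D.component (d x)) ∧
      (∀ x ∉ T, Z x = 0) ∧ (∀ x y, Z x * Z y = -(Z y * Z x)) ∧ (∀ x, Z x * Z x = 0) ∧
      (∀ x, Y x ^ (s.count x + 1) = 0) ∧
      ∀ t : List X, t.Nodup → (∀ x ∈ t, x ∈ T) →
        ((∏ x ∈ s.toFinset, Y x ^ s.count x : Subalgebra.center F (ExteriorAlgebra F L)) :
          ExteriorAlgebra F L) * (t.map Z).prod ≠ 0 := by
  -- One index for each occurrence of `x` in `s`. Then `Y x` is a sum of `s.count x` square-zero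
  -- monomials: its power of that exponent is a factorial times their product, and the next power is
  -- zero.
  let P : Finset (Σ _ : X, ℕ) := s.toFinset.sigma fun x => Finset.range (s.count x)
  have hP : ∀ {x j}, j < s.count x → (⟨x, j⟩ : Σ _ : X, ℕ) ∈ P := fun {x j} h =>
    Finset.mem_sigma.2 ⟨Multiset.mem_toFinset.2 (Multiset.count_pos.1 (Nat.zero_lt_of_lt h)),
      Finset.mem_range.2 h⟩
  obtain ⟨S, hS, hS', hdisj⟩ := exists_disjoint_family
    (fun (i : (Σ _ : X, ℕ) ⊕ X) (v : Finset ℕ) => v.Nonempty ∧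
      i.elim (fun p => ∑ i ∈ v, D.deg i = d p.1 ∧ Even v.card)
        fun x => ∑ i ∈ v, D.deg i = d x ∧ Odd v.card) (P.disjSum T) (by
      rintro (⟨x, j⟩ | x) hi U
      · exact hs x (Multiset.mem_toFinset.1 (Finset.mem_sigma.1 (Finset.inl_mem_disjSum.1 hi)).1) U
      · exact hT x (Finset.inr_mem_disjSum.1 hi) U)
  have hSP : ∀ p ∈ P, _ := fun p hp => hS (Sum.inl p) (Finset.inl_mem_disjSum.2 hp)
  have hST : ∀ x ∈ T, _ := fun x hx => hS (Sum.inr x) (Finset.inr_mem_disjSum.2 hx)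
  have heven : ∀ p, Even (S (Sum.inl p)).card := fun p => by
    by_cases hp : p ∈ P
    · exact (hSP p hp).2.2
    · rw [hS' _ (by simpa using hp)]; simp
  let w : (Σ _ : X, ℕ) → Subalgebra.center F (ExteriorAlgebra F L) := fun p =>
    ⟨D.monomial (S (Sum.inl p)), D.monomial_mem_center (heven p)⟩
  have hw : ∀ p ∈ P, w p * w p = 0 := fun p hp => Subtype.ext (D.monomial_mul_self (hSP p hp).1)
  let Y : X → Subalgebra.center F (ExteriorAlgebra F L) := fun x =>
    ∑ j ∈ Finset.range (s.count x), w ⟨x, j⟩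
  let Z : X → ExteriorAlgebra F L := fun x => if x ∈ T then D.monomial (S (Sum.inr x)) else 0
  have hZT : ∀ x ∈ T, Z x = D.monomial (S (Sum.inr x)) := fun x hx => if_pos hx
  have hZ0 : ∀ x ∉ T, Z x = 0 := fun x hx => if_neg hx
  refine ⟨Y, Z, fun x => ?_, fun x => ?_, hZ0, fun x y => ?_, fun x => ?_, fun x => ?_,
    fun t ht htT => ?_⟩
  · simp only [Y, AddSubmonoidClass.coe_finsetSum]
    exact sum_mem fun j hj => by
      have := D.monomial_mem (S (Sum.inl ⟨x, j⟩))
      rwa [(hSP _ (hP (Finset.mem_range.1 hj))).2.1] at this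
  · by_cases hx : x ∈ T
    · have := D.monomial_mem (S (Sum.inr x))
      rwa [(hST x hx).2.1, ← hZT x hx] at this
    · rw [hZ0 x hx]; exact zero_mem _
  · by_cases hx : x ∈ T
    · by_cases hy : y ∈ T
      · rw [hZT x hx, hZT y hy, D.monomial_mul_monomial_of_odd (hST x hx).2.2 (hST y hy).2.2]
      · simp [hZ0 y hy]
    · simp [hZ0 x hx]
  · by_cases hx : x ∈ T
    · rw [hZT x hx, D.monomial_mul_self (hST x hx).1]
    · simp [hZ0 x hx]
  · have := sum_pow_card_add_one_of_mul_self_eq_zero (Finset.range (s.count x))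
      (fun j => w ⟨x, j⟩) fun j hj => hw _ (hP (Finset.mem_range.1 hj))
    rwa [Finset.card_range] at this
  · have h1 : ∏ x ∈ s.toFinset, Y x ^ s.count x =
        ((∏ x ∈ s.toFinset, (s.count x).factorial : ℕ) : Subalgebra.center F (ExteriorAlgebra F L))
          * ∏ p ∈ P, w p := by
      rw [Finset.prod_sigma, Nat.cast_prod, ← Finset.prod_mul_distrib]
      refine Finset.prod_congr rfl fun x _ => ?_
      have := sum_pow_card_of_mul_self_eq_zero (Finset.range (s.count x))
        (fun j => w ⟨x, j⟩) fun j hj => hw _ (hP (Finset.mem_range.1 hj))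
      rwa [Finset.card_range] at this
    have h2 : ((∏ p ∈ P, w p : Subalgebra.center F (ExteriorAlgebra F L)) : ExteriorAlgebra F L) =
        (P.toList.map fun p => D.monomial (S (Sum.inl p))).prod := by
      rw [← Finset.prod_map_toList, ← Subalgebra.coe_val, map_list_prod, List.map_map]
      rfl
    have h3 : (t.map Z).prod = (t.map fun x => D.monomial (S (Sum.inr x))).prod := by
      rw [List.map_congr_left fun x hx => hZT x (htT x hx)]
    have h4 := D.prod_monomial_ne_zero S hdisj (P.toList.map Sum.inl ++ t.map Sum.inr)
      (List.Nodup.append (P.nodup_toList.map Sum.inl_injective) (ht.map Sum.inr_injective)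
        (by simp [List.disjoint_left]))
    rw [List.map_append, List.prod_append, List.map_map, List.map_map] at h4
    rw [h1, h3, MulMemClass.coe_mul, h2, mul_assoc, SubringClass.coe_natCast, ← nsmul_eq_mul,
      ← Nat.cast_smul_eq_nsmul F]
    -- Characteristic zero enters here: the factorials are nonzero in `F`.
    refine smul_ne_zero (Nat.cast_ne_zero.2 (Finset.prod_ne_zero_iff.2 fun x _ =>
      Nat.factorial_ne_zero _)) h4

end Generic

end

end GradedGrassmann
namespace GradedGrassmann

noncomputable section

/-! ### Graded substitutions and T-ideals -/

section TIdeals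

variable {F : Type*} [Field F] {A : Type*} [Ring A] [Algebra F A]

theorem lift_mem_of_mem_freeComponent (𝒜 : ℤ → Submodule F A) [SetLike.GradedMonoid 𝒜]
    {a : ℤ × ℕ → A} (ha : ∀ p, a p ∈ 𝒜 p.1) {i : ℤ} {f : FreeGr F} (hf : f ∈ freeComponent F i) :
    FreeAlgebra.lift F a f ∈ 𝒜 i := by
  unfold freeComponent at hf
  induction hf using Submodule.span_induction with
  | mem f hf =>
    obtain ⟨l, rfl, rfl⟩ := hf
    have : FreeAlgebra.lift F a (l.map (FreeAlgebra.ι F)).prod = (l.map a).prod := by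
      simp [map_list_prod, Function.comp_def]
    rw [this]
    exact SetLike.list_prod_map_mem_graded l Prod.fst a fun p _ => ha p
  | zero => simp
  | add _ _ _ _ h h' => rw [map_add]; exact add_mem h h'
  | smul c _ _ h => rw [map_smul]; exact Submodule.smul_mem _ _ h

theorem word_mem_freeComponent (l : List (ℤ × ℕ)) :
    (l.map (FreeAlgebra.ι F)).prod ∈ freeComponent F (l.map Prod.fst).sum :=
  Submodule.subset_span ⟨l, rfl, rfl⟩

theorem ι_mem_freeComponent (p : ℤ × ℕ) : FreeAlgebra.ι F p ∈ freeComponent F p.1 := by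
  simpa using word_mem_freeComponent (F := F) [p]

instance freeComponent_gradedMonoid : SetLike.GradedMonoid (freeComponent F) where
  one_mem := by simpa using word_mem_freeComponent (F := F) []
  mul_mem := by
    intro i j a b ha hb
    unfold freeComponent at ha hb
    induction ha, hb using Submodule.span_induction₂ with
    | mem_mem a b ha hb =>
      obtain ⟨k, rfl, rfl⟩ := ha
      obtain ⟨l, rfl, rfl⟩ := hb
      simpa using word_mem_freeComponent (F := F) (k ++ l)
    | zero_left => simp
    | zero_right => simp
    | add_left _ _ _ _ _ _ h1 h2 => rw [add_mul]; exact add_mem h1 h2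
    | add_right _ _ _ _ _ _ h1 h2 => rw [mul_add]; exact add_mem h1 h2
    | smul_left c _ _ _ _ h => rw [smul_mul_assoc]; exact Submodule.smul_mem _ _ h
    | smul_right c _ _ _ _ h => rw [mul_smul_comm]; exact Submodule.smul_mem _ _ h

theorem isTIdeal_gradedIdentities (𝒜 : ℤ → Submodule F A) [GradedAlgebra 𝒜] :
    IsTIdeal (gradedIdentities 𝒜) := by
  intro φ hφ f hf
  rw [mem_gradedIdentities] at hf ⊢
  intro a ha
  have h : (FreeAlgebra.lift F a).comp φ =
      FreeAlgebra.lift F fun p => FreeAlgebra.lift F a (φ (FreeAlgebra.ι F p)) := by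
    ext p; simp
  rw [← AlgHom.comp_apply, h]
  exact hf _ fun p => lift_mem_of_mem_freeComponent 𝒜 ha (hφ _ _ (ι_mem_freeComponent p))

theorem subset_tIdealSpan {S : Set (FreeGr F)} {f : FreeGr F} (hf : f ∈ S) : f ∈ tIdealSpan S := by
  rw [tIdealSpan, TwoSidedIdeal.mem_sInf]
  exact fun I hI => hI.2 f hf

theorem isTIdeal_tIdealSpan (S : Set (FreeGr F)) : IsTIdeal (tIdealSpan S) := by
  intro φ hφ f hf
  rw [tIdealSpan, TwoSidedIdeal.mem_sInf] at hf ⊢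
  exact fun I hI => hI.1 φ hφ f (hf I hI)

theorem tIdealSpan_le_gradedIdentities (𝒜 : ℤ → Submodule F A) [GradedAlgebra 𝒜]
    {S : Set (FreeGr F)} (h : ∀ f ∈ S, f ∈ gradedIdentities 𝒜) :
    tIdealSpan S ≤ gradedIdentities 𝒜 :=
  sInf_le ⟨isTIdeal_gradedIdentities 𝒜, h⟩

theorem commute_commutator_of_span {W : Set A} (hW : Submodule.span F W = ⊤)
    (h : ∀ a ∈ W, ∀ b ∈ W, ∀ c ∈ W, Commute (a * b - b * a) c) (a b c : A) :
    Commute (a * b - b * a) c := by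
  have hmem : ∀ a, a ∈ Submodule.span F W := fun a => hW ▸ Submodule.mem_top
  have ha := hmem a
  have hb := hmem b
  induction ha, hb using Submodule.span_induction₂ with
  | mem_mem a b ha hb =>
    have hc := hmem c
    induction hc using Submodule.span_induction with
    | mem c hc => exact h a ha b hb c hc
    | zero => exact Commute.zero_right _
    | add _ _ _ _ h h' => exact h.add_right h'
    | smul r _ _ h => exact h.smul_right r
  | zero_left => simp
  | zero_right => simp
  | add_left x y z _ _ _ h1 h2 =>
    rw [show (x + y) * z - z * (x + y) = (x * z - z * x) + (y * z - z * y) by noncomm_ring]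
    exact h1.add_left h2
  | add_right x y z _ _ _ h1 h2 =>
    rw [show x * (y + z) - (y + z) * x = (x * y - y * x) + (x * z - z * x) by noncomm_ring]
    exact h1.add_left h2
  | smul_left r _ _ _ _ h =>
    rw [smul_mul_assoc, mul_smul_comm, ← smul_sub]; exact h.smul_left r
  | smul_right r _ _ _ _ h =>
    rw [smul_mul_assoc, mul_smul_comm, ← smul_sub]; exact h.smul_left r

theorem span_quotient_words (I : TwoSidedIdeal (FreeGr F)) :
    Submodule.span F (Set.range fun l : List (ℤ × ℕ) =>
      quotientMap I (l.map (FreeAlgebra.ι F)).prod) = ⊤ := by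
  have h : Submodule.span F (Set.range fun l : List (ℤ × ℕ) => (l.map (FreeAlgebra.ι F)).prod) =
    ⊤ := eq_top_iff.2 fun f _ => mem_span_words f
  have h' := congrArg (Submodule.map (quotientMap I).toLinearMap) h
  rw [Submodule.map_span, Submodule.map_top, LinearMap.range_eq_top.2 (quotientMap_surjective I),
    ← Set.range_comp] at h'
  exact h'

/-- The generators involve only variables, but graded endomorphisms carry variables to words of the
same degree, and words span the quotient. -/
theorem commute_commutator_quotient_definingV1
    (a b c : (tIdealSpan (definingV1 F)).ringCon.Quotient) : Commute (a * b - b * a) c := by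
  refine commute_commutator_of_span (span_quotient_words _) ?_ a b c
  rintro _ ⟨k, rfl⟩ _ ⟨l, rfl⟩ _ ⟨r, rfl⟩
  -- The indices `0`, `1`, `2` keep the three variables distinct even when the degrees coincide.
  let σ : ℤ × ℕ → FreeGr F := fun p =>
    if p = ((k.map Prod.fst).sum, 0) then (k.map (FreeAlgebra.ι F)).prod
    else if p = ((l.map Prod.fst).sum, 1) then (l.map (FreeAlgebra.ι F)).prod
    else if p = ((r.map Prod.fst).sum, 2) then (r.map (FreeAlgebra.ι F)).prod
    else FreeAlgebra.ι F p
  have hσ : ∀ p, σ p ∈ freeComponent F p.1 := by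
    intro p
    simp only [σ]
    split_ifs with h1 h2 h3
    · rw [h1]; exact word_mem_freeComponent k
    · rw [h2]; exact word_mem_freeComponent l
    · rw [h3]; exact word_mem_freeComponent r
    · exact ι_mem_freeComponent p
  have h := isTIdeal_tIdealSpan (definingV1 F) (FreeAlgebra.lift F σ)
    (fun i f hf => lift_mem_of_mem_freeComponent (freeComponent F) hσ hf) _
    (subset_tIdealSpan ⟨(k.map Prod.fst).sum, (l.map Prod.fst).sum, (r.map Prod.fst).sum, 0, 1, 2,
      rfl⟩)
  rw [← quotientMap_eq_zero_iff] at h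
  simp only [Ring.lie_def, x, map_sub, map_mul, FreeAlgebra.lift_ι_apply, σ, Prod.mk.injEq,
    one_ne_zero, zero_ne_one, OfNat.ofNat_ne_zero, OfNat.ofNat_ne_one, and_false,
    if_true, if_false] at h
  exact sub_eq_zero.1 h

end TIdeals

/-! ### Comparing multiplicities in multisets -/

section Counting

variable {X : Type*} [DecidableEq X]

theorem exists_count_lt {s t : Multiset X} (hst : t ≠ s) (h : s.card ≤ t.card) :
    ∃ x, s.count x < t.count x := by
  by_contra! hc
  exact hst (Multiset.eq_of_le_of_card_le (Multiset.le_iff_count.2 hc) h)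

theorem multiset_prod_map_eq_zero {C : Type*} [CommRing C] (Y : X → C) {s t : Multiset X}
    (hY : ∀ x, Y x ^ (s.count x + 1) = 0) {x : X} (hx : s.count x < t.count x) :
    (t.map Y).prod = 0 := by
  rw [Finset.prod_multiset_map_count]
  exact Finset.prod_eq_zero (Multiset.mem_toFinset.2 (Multiset.count_pos.1 (Nat.zero_lt_of_lt hx)))
    (pow_eq_zero_of_le hx (hY x))

end Counting

/-! ### The two ideals of graded identities -/

section Varieties

variable {F L : Type*} [Field F] [AddCommGroup L] [Module F L] {m n : ℤ}

namespace TwoInduced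

theorem tIdealSpan_definingV1_le (D : TwoInduced F L m n ⊤ ⊤) :
    tIdealSpan (definingV1 F) ≤ gradedIdentities D.component := by
  refine tIdealSpan_le_gradedIdentities _ ?_
  rintro _ ⟨i, j, l, p, q, r, rfl⟩
  rw [mem_gradedIdentities]
  intro a _
  simp only [Ring.lie_def, map_sub, map_mul, FreeAlgebra.lift_ι_apply]
  exact sub_eq_zero.2 (Subalgebra.mem_center_iff.1 (D.commutator_mem_center _ _) _).symm

theorem gradedIdentities_eq_definingV1 [CharZero F] (D : TwoInduced F L m n ⊤ ⊤)
    (hm : m < 0) (hn : 0 < n) (hmn : Int.gcd m n = 1) (he : Even (m * n)) :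
    gradedIdentities D.component = tIdealSpan (definingV1 F) := by
  refine le_antisymm (le_of_separating (M := ExteriorAlgebra F L) D.tIdealSpan_definingV1_le
    (fun i : Multiset (ℤ × ℕ) × {T : Finset (ℤ × ℕ) // Even T.card} =>
      (i.1.toList.map (FreeAlgebra.ι F)).prod * pairComm (i.2.1.toList.map (FreeAlgebra.ι F)))
    -- The commutator part is compared first: once it equals `T`, its value is annihilated by every
    -- `Z x`, so only the central parts `Y x` of the remaining letters count.
    (fun i => toLex (i.2.1.card, i.1.card)) (fun l => ?_) ?_) D.tIdealSpan_definingV1_le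
  · have h := prod_mul_pairComm_mem_span (F := F) commute_commutator_quotient_definingV1
      (fun x => quotientMap (tIdealSpan (definingV1 F)) (FreeAlgebra.ι F x)) l []
    simpa [pairComm, map_list_prod, map_pairComm, Function.comp_def] using h
  · rintro ⟨s, T, hTe⟩
    obtain ⟨Y, Z, hYm, hZm, hZT, hZ, hZ', hY, hne⟩ := D.exists_generic Prod.fst s T
      (fun x _ U => (D.exists_finset_of_degree_of_parity hm hn hmn he U x.1).1)
      (fun x _ U => (D.exists_finset_of_degree_of_parity hm hn hmn he U x.1).2)
    let φ := FreeAlgebra.lift F fun x => (Y x : ExteriorAlgebra F L) + Z x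
    have key : ∀ (s' : Multiset (ℤ × ℕ)) (T' : Finset (ℤ × ℕ)), Even T'.card →
        (∀ x, Z x * (T'.toList.map Z).prod = 0) → ∃ k : ℕ,
        φ ((s'.toList.map (FreeAlgebra.ι F)).prod * pairComm (T'.toList.map (FreeAlgebra.ι F))) =
          2 ^ k * (((s'.map Y).prod : Subalgebra.center F (ExteriorAlgebra F L)) *
            (T'.toList.map Z).prod) := by
      intro s' T' hT' h
      obtain ⟨k, hk⟩ := pairComm_center_add Y hZ T'.toList (by simpa using hT')
      refine ⟨k, ?_⟩
      have h1 : φ (s'.toList.map (FreeAlgebra.ι F)).prod =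
          (s'.toList.map fun x => (Y x : ExteriorAlgebra F L) + Z x).prod := by
        simp [φ, map_list_prod, Function.comp_def]
      have h2 : φ (pairComm (T'.toList.map (FreeAlgebra.ι F))) =
          2 ^ k * (T'.toList.map Z).prod := by
        rw [← hk, map_pairComm, List.map_map]
        simp [φ, Function.comp_def]
      have h3 : (s'.toList.map Y).prod = (s'.map Y).prod := by
        conv_rhs => rw [← s'.coe_toList, Multiset.map_coe, Multiset.prod_coe]
      have h4 : Commute ((s'.toList.map fun x => (Y x : ExteriorAlgebra F L) + Z x).prod)
          ((2 : ExteriorAlgebra F L) ^ k) :=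
        Commute.pow_right (Nat.cast_ofNat (R := ExteriorAlgebra F L) (n := 2) ▸
          Nat.commute_cast _ 2) k
      rw [map_mul, h1, h2, ← mul_assoc, h4.eq, mul_assoc, prod_center_add_mul Y Z h, h3]
    have hZprod : ∀ x, Z x * (T.toList.map Z).prod = 0 := fun x => by
      by_cases hx : x ∈ T
      · exact mul_prod_of_mem hZ hZ' (Finset.mem_toList.2 hx)
      · rw [hZT x hx, zero_mul]
    refine ⟨φ.toLinearMap, fun f hf => ?_, ?_, ?_⟩
    · exact (mem_gradedIdentities _ f).1 hf _ fun x => add_mem (hYm x) (hZm x)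
    · obtain ⟨k, hk⟩ := key s T hTe hZprod
      rw [AlgHom.toLinearMap_apply, hk, Finset.prod_multiset_map_count]
      have h := hne T.toList T.nodup_toList fun x hx => Finset.mem_toList.1 hx
      have h2 : ((2 : ExteriorAlgebra F L) ^ k) = algebraMap F _ (2 ^ k) := by
        rw [map_pow, map_ofNat]
      rw [h2, ← Algebra.smul_def]
      exact smul_ne_zero (pow_ne_zero _ two_ne_zero) h
    · rintro ⟨s', T', hTe'⟩ hne' hle
      rw [Prod.Lex.toLex_le_toLex] at hle
      rw [AlgHom.toLinearMap_apply]
      by_cases hTT : T' = T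
      · subst hTT
        have hs : s' ≠ s := fun h => hne' (by rw [h])
        obtain ⟨x, hx⟩ := exists_count_lt hs (by simpa using hle)
        obtain ⟨k, hk⟩ := key s' T' hTe' hZprod
        rw [hk, multiset_prod_map_eq_zero Y hY hx]
        simp
      · have hcard : T.card ≤ T'.card := by
          rcases hle with h | h
          · exact h.le
          · exact h.1.le
        -- A different set at least as large as `T` has an element outside `T`, where `Z` vanishes.
        obtain ⟨x, hx, hxT⟩ : ∃ x ∈ T', x ∉ T := by
          by_contra! hc
          exact hTT (Finset.eq_of_subset_of_card_le hc hcard)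
        have h0 : (T'.toList.map Z).prod = 0 :=
          List.prod_eq_zero (List.mem_map.2 ⟨x, Finset.mem_toList.2 hx, hZT x hxT⟩)
        obtain ⟨k, hk⟩ := key s' T' hTe' fun x => by rw [h0, mul_zero]
        rw [hk, h0]
        simp

theorem commute_of_mem_component_even (D : TwoInduced F L m n ⊤ ⊤) (ho : Odd (m * n)) {i : ℤ}
    (hi : Even i) {a : ExteriorAlgebra F L} (ha : a ∈ D.component i) (b : ExteriorAlgebra F L) :
    Commute a b := by
  unfold component at ha
  induction ha using Submodule.span_induction with
  | mem a ha =>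
    obtain ⟨s, rfl, rfl⟩ := ha
    exact D.monomial_commute (by rwa [← Nat.not_odd_iff_even, D.odd_card_iff ho,
      Int.not_odd_iff_even]) b
  | zero => exact Commute.zero_left _
  | add _ _ _ _ h h' => exact h.add_left h'
  | smul r _ _ h => exact h.smul_left r

theorem anticommute_of_mem_component_odd (D : TwoInduced F L m n ⊤ ⊤) (ho : Odd (m * n)) {i j : ℤ}
    (hi : Odd i) (hj : Odd j) {a b : ExteriorAlgebra F L} (ha : a ∈ D.component i)
    (hb : b ∈ D.component j) : a * b + b * a = 0 := by
  unfold component at ha hb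
  induction ha, hb using Submodule.span_induction₂ with
  | mem_mem a b ha hb =>
    obtain ⟨s, rfl, rfl⟩ := ha
    obtain ⟨t, rfl, rfl⟩ := hb
    rw [D.monomial_mul_monomial_of_odd ((D.odd_card_iff ho s).2 hi) ((D.odd_card_iff ho t).2 hj),
      neg_add_cancel]
  | zero_left => simp
  | zero_right => simp
  | add_left _ _ _ _ _ _ h1 h2 => rw [add_mul, mul_add, add_add_add_comm, h1, h2, add_zero]
  | add_right _ _ _ _ _ _ h1 h2 => rw [add_mul, mul_add, add_add_add_comm, h1, h2, add_zero]
  | smul_left c _ _ _ _ h => rw [smul_mul_assoc, mul_smul_comm, ← smul_add, h, smul_zero]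
  | smul_right c _ _ _ _ h => rw [smul_mul_assoc, mul_smul_comm, ← smul_add, h, smul_zero]

theorem tIdealSpan_definingV2_le (D : TwoInduced F L m n ⊤ ⊤) (ho : Odd (m * n)) :
    tIdealSpan (definingV2 F) ≤ gradedIdentities D.component := by
  refine tIdealSpan_le_gradedIdentities _ ?_
  rintro _ (⟨i, j, p, q, hij, rfl⟩ | ⟨i, j, p, q, ⟨hi, hj⟩, rfl⟩)
  · rw [mem_gradedIdentities]
    intro a ha
    simp only [Ring.lie_def, map_sub, map_mul, FreeAlgebra.lift_ι_apply]
    rcases hij with hi | hj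
    · exact sub_eq_zero.2 (D.commute_of_mem_component_even ho hi (ha (i, p)) _)
    · exact sub_eq_zero.2 (D.commute_of_mem_component_even ho hj (ha (j, q)) _).symm
  · rw [mem_gradedIdentities]
    intro a ha
    simp only [map_add, map_mul, FreeAlgebra.lift_ι_apply]
    exact D.anticommute_of_mem_component_odd ho hi hj (ha (i, p)) (ha (j, q))

theorem gradedIdentities_eq_definingV2 [CharZero F] (D : TwoInduced F L m n ⊤ ⊤)
    (hm : m < 0) (hn : 0 < n) (hmn : Int.gcd m n = 1) (ho : Odd (m * n)) :
    gradedIdentities D.component = tIdealSpan (definingV2 F) := by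
  refine le_antisymm (le_of_separating (M := ExteriorAlgebra F L) (D.tIdealSpan_definingV2_le ho)
    (fun s : {s : Multiset (ℤ × ℕ) // ∀ x, Odd x.1 → s.count x ≤ 1} =>
      (s.1.toList.map (FreeAlgebra.ι F)).prod)
    (fun s => s.1.card) (fun l => ?_) ?_) (D.tIdealSpan_definingV2_le ho)
  · have hcomm : ∀ x y : ℤ × ℕ, (Even x.1 ∨ Even y.1) →
        quotientMap (tIdealSpan (definingV2 F)) (FreeAlgebra.ι F x) *
          quotientMap (tIdealSpan (definingV2 F)) (FreeAlgebra.ι F y) =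
        quotientMap (tIdealSpan (definingV2 F)) (FreeAlgebra.ι F y) *
          quotientMap (tIdealSpan (definingV2 F)) (FreeAlgebra.ι F x) := fun x y h => by
      have := quotientMap_eq_zero_iff.2 (subset_tIdealSpan (S := definingV2 F)
        (Or.inl ⟨x.1, y.1, x.2, y.2, h, rfl⟩))
      rw [Ring.lie_def, map_sub, map_mul, map_mul] at this
      exact sub_eq_zero.1 this
    have hanti : ∀ x y : ℤ × ℕ, Odd x.1 → Odd y.1 →
        quotientMap (tIdealSpan (definingV2 F)) (FreeAlgebra.ι F x) *
          quotientMap (tIdealSpan (definingV2 F)) (FreeAlgebra.ι F y) +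
        quotientMap (tIdealSpan (definingV2 F)) (FreeAlgebra.ι F y) *
          quotientMap (tIdealSpan (definingV2 F)) (FreeAlgebra.ι F x) = 0 := fun x y hx hy => by
      have := quotientMap_eq_zero_iff.2 (subset_tIdealSpan (S := definingV2 F)
        (Or.inr ⟨x.1, y.1, x.2, y.2, ⟨hx, hy⟩, rfl⟩))
      rwa [map_add, map_mul, map_mul] at this
    have h := prod_mem_span_of_commute_up_to_sign (F := F)
      (fun x => quotientMap (tIdealSpan (definingV2 F)) (FreeAlgebra.ι F x)) (fun x y => by
        by_cases hxy : Even x.1 ∨ Even y.1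
        · exact ⟨1, by rw [one_smul, hcomm x y hxy]⟩
        · simp only [not_or, Int.not_even_iff_odd] at hxy
          exact ⟨-1, by
            rw [Units.neg_smul, one_smul]
            exact eq_neg_of_add_eq_zero_left (hanti x y hxy.1 hxy.2)⟩)
      -- Anticommutation of an odd variable with itself reads `2 * x ^ 2 = 0`, and `2` is invertible
      -- in `F`.
      (fun x => Odd x.1) (fun x hx => by
        have := hanti x x hx hx
        rw [← two_smul F] at this
        exact (smul_eq_zero.1 this).resolve_left two_ne_zero) l
    simpa [map_list_prod, Function.comp_def] using h
  · rintro ⟨s, hs⟩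
    obtain ⟨Y, Z, hYm, hZm, hZT, hZ, hZ', hY, hne⟩ := D.exists_generic Prod.fst
      (s.filter fun x => ¬ Odd x.1) (s.filter fun x => Odd x.1).toFinset
      (fun x hx U => by
        obtain ⟨v, h1, h2, h3⟩ := D.exists_finset_of_degree hm hn hmn U x.1
        refine ⟨v, h1, h2, h3, ?_⟩
        rw [← Nat.not_odd_iff_even, D.odd_card_iff ho, h3]
        exact (Multiset.mem_filter.1 hx).2)
      (fun x hx U => by
        obtain ⟨v, h1, h2, h3⟩ := D.exists_finset_of_degree hm hn hmn U x.1
        refine ⟨v, h1, h2, h3, ?_⟩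
        rw [D.odd_card_iff ho, h3]
        exact (Multiset.mem_filter.1 (Multiset.mem_toFinset.1 hx)).2)
    let φ := FreeAlgebra.lift F fun x : ℤ × ℕ =>
      if Odd x.1 then Z x else (Y x : ExteriorAlgebra F L)
    have key : ∀ s' : Multiset (ℤ × ℕ), φ (s'.toList.map (FreeAlgebra.ι F)).prod =
        ((((s'.filter fun x => ¬ Odd x.1).map Y).prod :
          Subalgebra.center F (ExteriorAlgebra F L)) : ExteriorAlgebra F L) *
          ((s'.toList.filter fun x => Odd x.1).map Z).prod := by
      intro s'
      have h1 : φ (s'.toList.map (FreeAlgebra.ι F)).prod = (s'.toList.map fun x : ℤ × ℕ =>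
          if Odd x.1 then Z x else (Y x : ExteriorAlgebra F L)).prod := by
        simp [φ, map_list_prod, Function.comp_def]
      have h2 : ((s'.toList.filter fun x => ¬ Odd x.1).map Y).prod =
          ((s'.filter fun x => ¬ Odd x.1).map Y).prod := by
        conv_rhs => rw [← s'.coe_toList, Multiset.filter_coe, Multiset.map_coe, Multiset.prod_coe]
      rw [h1, prod_ite_center, h2]
    refine ⟨φ.toLinearMap, fun f hf => ?_, ?_, ?_⟩
    · refine (mem_gradedIdentities _ f).1 hf _ fun x => ?_
      split_ifs
      exacts [hZm x, hYm x]
    · rw [AlgHom.toLinearMap_apply, key, Finset.prod_multiset_map_count]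
      refine hne _ ?_ fun x hx => by simpa using hx
      rw [← Multiset.coe_nodup, ← Multiset.filter_coe, Multiset.coe_toList,
        Multiset.nodup_iff_count_le_one]
      intro x
      rw [Multiset.count_filter]
      split_ifs with hx
      exacts [hs x hx, zero_le_one]
    · rintro ⟨s', hs'⟩ hne' hle
      obtain ⟨x, hx⟩ := exists_count_lt (fun h => hne' (Subtype.ext h)) hle
      rw [AlgHom.toLinearMap_apply, key]
      -- An odd variable in excess occurs once in `s'` and not in `s`, so its `Z` is zero; an even
      -- one in excess raises `Y x` to a vanishing power.
      by_cases ho : Odd x.1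
      · have h1 := hs' x ho
        have h2 : x ∉ s := Multiset.count_eq_zero.1 (by simp only at hx h1; omega)
        have h3 : x ∈ s' := Multiset.count_pos.1 (Nat.zero_lt_of_lt hx)
        have h0 : ((s'.toList.filter fun x => Odd x.1).map Z).prod = 0 :=
          List.prod_eq_zero (List.mem_map.2 ⟨x, by simp [h3, ho], hZT x (by simp [h2])⟩)
        rw [h0, mul_zero]
      · rw [multiset_prod_map_eq_zero Y hY (x := x)
          (by simpa only [Multiset.count_filter, ho, not_false_eq_true, if_true] using hx)]
        simp

theorem support_eq_univ (D : TwoInduced F L m n ⊤ ⊤) (hm : m < 0) (hn : 0 < n)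
    (hmn : Int.gcd m n = 1) : D.support = Set.univ := by
  refine Set.eq_univ_of_forall fun r h => ?_
  obtain ⟨s, -, -, rfl⟩ := D.exists_finset_of_degree hm hn hmn ∅ r
  exact D.monomial_ne_zero s ((Submodule.eq_bot_iff _).1 h _ (D.monomial_mem s))

/-- Two monomials of degree `r` and odd length with disjoint supports have commutator twice their
nonzero product. -/
theorem commutator_notMem_gradedIdentities [CharZero F] (D : TwoInduced F L m n ⊤ ⊤)
    (hm : m < 0) (hn : 0 < n) (hmn : Int.gcd m n = 1) (he : Even (m * n)) (r : ℤ) :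
    ⁅x F r 0, x F r 1⁆ ∉ gradedIdentities D.component := by
  obtain ⟨s, -, -, hs, hso⟩ := (D.exists_finset_of_degree_of_parity hm hn hmn he ∅ r).2
  obtain ⟨t, hst, -, ht, hto⟩ := (D.exists_finset_of_degree_of_parity hm hn hmn he s r).2
  rw [mem_gradedIdentities]
  intro h
  have h1 := h (fun p => if p = (r, 0) then D.monomial s else if p = (r, 1) then D.monomial t
    else 0) fun p => by
      split_ifs with h1 h2
      · rw [h1, ← hs]; exact D.monomial_mem s
      · rw [h2, ← ht]; exact D.monomial_mem t
      · exact zero_mem _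
  simp only [Ring.lie_def, map_sub, map_mul, FreeAlgebra.lift_ι_apply, Prod.mk.injEq, if_true,
    one_ne_zero, and_false, if_false] at h1
  obtain ⟨ε, e⟩ := D.exists_monomial_mul hst
  rw [D.monomial_mul_monomial_of_odd hto hso, e, sub_neg_eq_add, ← two_smul F] at h1
  exact smul_ne_zero (two_ne_zero (α := F)) ((smul_ne_zero_iff_ne ε).2 (D.monomial_ne_zero _)) h1

end TwoInduced

end Varieties

end

end GradedGrassmann

theorem theorem4p1 {F : Type*} [Field F] [CharZero F] {L : Type*} [AddCommGroup L] [Module F L]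
    {m n : ℤ} (hm : m < 0) (hn : 0 < n) (hmn : Int.gcd m n = 1)
    (E : GradedGrassmann.TwoInduced F L m n ⊤ ⊤)
    (E₁ : GradedGrassmann.TwoInduced F L (-1) 1 ⊤ ⊤)
    (E₂ : GradedGrassmann.TwoInduced F L (-1) 2 ⊤ ⊤) :
    E.support = Set.univ ∧
    (Odd (m * n) →
      GradedGrassmann.PIEquiv E.component E₁.component ∧
      GradedGrassmann.GeneratesVariety E.component (GradedGrassmann.definingV2 F)) ∧
    (Even (m * n) →
      GradedGrassmann.PIEquiv E.component E₂.component ∧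
      GradedGrassmann.GeneratesVariety E.component (GradedGrassmann.definingV1 F)) ∧
    ¬ GradedGrassmann.PIEquiv E₁.component E₂.component := by
  have h1 : GradedGrassmann.gradedIdentities E₁.component =
      GradedGrassmann.tIdealSpan (GradedGrassmann.definingV2 F) :=
    E₁.gradedIdentities_eq_definingV2 (by norm_num) (by norm_num) (by norm_num) (by decide)
  have h2 : GradedGrassmann.gradedIdentities E₂.component =
      GradedGrassmann.tIdealSpan (GradedGrassmann.definingV1 F) :=
    E₂.gradedIdentities_eq_definingV1 (by norm_num) (by norm_num) (by norm_num) (by decide)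
  refine ⟨E.support_eq_univ hm hn hmn, fun ho => ?_, fun he => ?_, fun h => ?_⟩
  · have h := E.gradedIdentities_eq_definingV2 hm hn hmn ho
    exact ⟨h.trans h1.symm, h⟩
  · have h := E.gradedIdentities_eq_definingV1 hm hn hmn he
    exact ⟨h.trans h2.symm, h⟩
  -- Degree `0` is even, so this commutator is among the defining identities of the odd case.
  · refine E₂.commutator_notMem_gradedIdentities (by norm_num) (by norm_num) (by norm_num)
      (by decide) 0 ?_
    rw [← show GradedGrassmann.gradedIdentities E₁.component = _ from h, h1]
    exact GradedGrassmann.subset_tIdealSpan (Or.inl ⟨0, 0, 0, 1, by simp, rfl⟩)
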